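/- Let $\Gamma$ be a countable group, and write $\mathcal F(\Gamma)$ for its nonempty finite subsets. For $K\in\mathcal F(\Gamma)$ and $\delta>0$ let $\mathcal B(K,\delta)$ be the set of $F\in\mathcal F(\Gamma)$ with $|\{t\in F: Kt\subseteq F\}|\ge(1-\delta)|F|$. Assume that $\Gamma$ is amenable, i.e. every $\mathcal B(K,\delta)$ is nonempty. Write $\lim_F\varphi(F)=c$ if for every $\varepsilon>0$ there are $K,\delta$ with $|\varphi(F)-c|<\varepsilon$ for all $F\in\mathcal B(K,\delta)$. Let $\Gamma$ act continuously on compact metrizable spaces $X$ and $Y$, and let $\pi\colon X\to Y$ be a factor map, i.e. a continuous $\Gamma$-equivariant surjection. For a finite open cover $\mathcal U$ of a space $Z$ put $\mathcal D(\mathcal U)=\min_{\mathcal W}\,\mathrm{ord}(\mathcal W)$, where $\mathcal W$ ranges over the finite open covers of $Z$ that refine $\mathcal U$ and $\mathrm{ord}(\mathcal W)=\max_{z\in Z}\sum_{W\in\mathcal W}1_W(z)-1$. For a finite open cover $\mathcal U$ of $X$, a closed set $K\subseteq X$ and $F\in\mathcal F(\Gamma)$ put $\mathcal U|_K=\{U\cap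 K:U\in\mathcal U\}$ (a cover of the space $K$) and $\mathcal U^F=\bigvee_{s\in F}s^{-1}\mathcal U$, the cover by all the sets $\bigcap_{s\in F}s^{-1}U_s$ with $U_s\in\mathcal U$. Fix a Følner sequence $(F_n)$ of $\Gamma$, i.e. $F_n\in\mathcal F(\Gamma)$ and $|sF_n\,\Delta\,F_n|/|F_n|\to0$ for every $s\in\Gamma$, and define $$\mathrm{mdim}(K)=\sup_{\mathcal U}\varlimsup_{n\to\infty}\frac{\mathcal D(\mathcal U^{F_n}|_K)}{|F_n|}.$$ For a $\Gamma$-invariant Borel probability measure $\nu$ on $Y$ define $$\mathcal D(\mathcal U|\nu)=\int_Y\mathcal D(\mathcal U|_{\pi^{-1}(y)})\,d\nu(y),\qquad \mathrm{mdim}(X|\nu)=\sup_{\mathcal U}\lim_F\frac{\mathcal D(\mathcal U^F|\nu)}{|F|}.$$ In both definitions $\mathcal U$ ranges over all finite open covers of $X$. Let $M_\Gamma(Y)$ be the set of $\Gamma$-invariant Borel probability measures on $Y$. Then the limits in the definition of $\mathrm{mdim}(X|\nu)$ exist and are finite, and $$\sup_{\nu\in M_\Gamma(Y)}\mathrm{mdim}(X|\nu)\le\sup_{y\in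 Y}\mathrm{mdim}(\pi^{-1}(y)).$$ -/

import Mathlib

open Filter Topology MeasureTheory
open scoped ENNReal NNReal symmDiff Pointwise

namespace MeanDim

section Group

variable {Γ : Type*} [Group Γ]

/-- `B(K, δ)`: the nonempty finite sets `F` with `|{t ∈ F : K t ⊆ F}| ≥ (1 - δ) |F|`. -/
def almostInvariant (K : Finset Γ) (δ : ℝ) : Set (Finset Γ) :=
  {F | F.Nonempty ∧
    (1 - δ) * (F.card : ℝ) ≤ (({t | t ∈ F ∧ ∀ k ∈ K, k * t ∈ F} : Set Γ).ncard : ℝ)}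

variable (Γ) in
/-- Amenability: every `B(K, δ)` is nonempty. -/
def IsAmenable : Prop :=
  ∀ K : Finset Γ, K.Nonempty → ∀ δ : ℝ, 0 < δ → (almostInvariant K δ).Nonempty

variable (Γ) in
/-- The filter generated by the sets `B(K, δ)`: a limit along it is a limit "as `F` becomes more
and more invariant". -/
def invariantFilter : Filter (Finset Γ) :=
  ⨅ (K : Finset Γ) (_ : K.Nonempty) (δ : ℝ) (_ : 0 < δ), 𝓟 (almostInvariant K δ)

/-- A (left) Følner sequence of nonempty finite sets: `|s Fₙ ∆ Fₙ| / |Fₙ| → 0` for all `s`. -/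
structure IsFolnerSeq (F : ℕ → Finset Γ) : Prop where
  nonempty : ∀ n, (F n).Nonempty
  tendsto : ∀ s : Γ,
    Tendsto (fun n => (((s • (F n : Set Γ)) ∆ (F n : Set Γ)).ncard : ℝ) / ((F n).card : ℝ))
      atTop (𝓝 0)

end Group

section Covers

variable {Z : Type*}

/-- Finite open covers, as sets of subsets. -/
structure IsFiniteOpenCover [TopologicalSpace Z] (𝒰 : Set (Set Z)) : Prop where
  finite : 𝒰.Finite
  isOpen : ∀ U ∈ 𝒰, IsOpen U
  sUnion_eq : ⋃₀ 𝒰 = Set.univ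

/-- `𝒲` refines `𝒰`. -/
def Refines (𝒲 𝒰 : Set (Set Z)) : Prop :=
  ∀ W ∈ 𝒲, ∃ U ∈ 𝒰, W ⊆ U

/-- `ord 𝒲 = max_z ∑_{W ∈ 𝒲} 1_W(z) - 1`. -/
noncomputable def ord (𝒲 : Set (Set Z)) : ℕ∞ :=
  (⨆ z : Z, ({W | W ∈ 𝒲 ∧ z ∈ W} : Set (Set Z)).encard) - 1

/-- `D(𝒰)`: the minimal order of a finite open cover refining `𝒰`. -/
noncomputable def coverDim [TopologicalSpace Z] (𝒰 : Set (Set Z)) : ℕ∞ :=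
  ⨅ (𝒲 : Set (Set Z)) (_ : IsFiniteOpenCover 𝒲) (_ : Refines 𝒲 𝒰), ord 𝒲

/-- The restriction `𝒰|_K = {U ∩ K : U ∈ 𝒰}`, as a family of subsets of the subspace `K`. -/
def restrictCover (𝒰 : Set (Set Z)) (K : Set Z) : Set (Set K) :=
  (fun U : Set Z => (Subtype.val ⁻¹' U : Set K)) '' 𝒰

/-- `𝒰^F = ⋁_{s ∈ F} s⁻¹ 𝒰`: all intersections `⋂_{s ∈ F} s⁻¹ U_s` with `U_s ∈ 𝒰`. -/
def coverPow {Γ : Type*} [SMul Γ Z] (𝒰 : Set (Set Z)) (F : Finset Γ) : Set (Set Z) :=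
  {A | ∃ U : Γ → Set Z, (∀ s ∈ F, U s ∈ 𝒰) ∧ A = ⋂ s ∈ F, (fun z : Z => s • z) ⁻¹' (U s)}

end Covers

section MeanDimension

variable {Γ X Y : Type*} [Group Γ] [TopologicalSpace X] [MulAction Γ X]

/-- The mean dimension of a subset `K` of `X` along the sequence `F`:
`sup_𝒰 limsup_n D(𝒰^{Fₙ}|_K) / |Fₙ|`, with `𝒰` ranging over the finite open covers of `X`. -/
noncomputable def mdimSubset (F : ℕ → Finset Γ) (K : Set X) : ℝ≥0∞ :=
  ⨆ (𝒰 : Set (Set X)) (_ : IsFiniteOpenCover 𝒰),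
    limsup (fun n => (coverDim (restrictCover (coverPow 𝒰 (F n)) K) : ℝ≥0∞) /
      ((F n).card : ℝ≥0∞)) atTop

/-- `D(𝒰|ν) = ∫ D(𝒰|_{π⁻¹(y)}) dν(y)`. -/
noncomputable def coverDimGiven [MeasurableSpace Y] (π : X → Y) (ν : Measure Y)
    (𝒰 : Set (Set X)) : ℝ≥0∞ :=
  ∫⁻ y, (coverDim (restrictCover 𝒰 (π ⁻¹' {y})) : ℝ≥0∞) ∂ν

variable (Γ) in
/-- The mean dimension of `X` given `ν`: `sup_𝒰 lim_F D(𝒰^F|ν) / |F|`. The limit is written as the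
upper limit; that it is a limit is part of the theorem. -/
noncomputable def mdimGiven [MeasurableSpace Y] (π : X → Y) (ν : Measure Y) : ℝ≥0∞ :=
  ⨆ (𝒰 : Set (Set X)) (_ : IsFiniteOpenCover 𝒰),
    limsup (fun F : Finset Γ => coverDimGiven π ν (coverPow 𝒰 F) / (F.card : ℝ≥0∞))
      (invariantFilter Γ)

end MeanDimension

end MeanDim

namespace MeanDim

/-! ### Quasitilings and the Ornstein–Weiss lemma -/

section Quasitiling

variable {Γ : Type*} [Group Γ]

/-! For invariant ν the set function A ↦ D(𝒰^A|ν) is nonnegative, at most |A|·D(𝒰), subadditive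
under unions and invariant under right translation, so the Ornstein–Weiss lemma
`exists_tendsto_div_card` yields its limit after division by |A|. A Følner sequence converges along
the invariance filter, so the limit can be computed along it. Reverse Fatou, with the constant D(𝒰)
as dominating function, then moves the upper limit inside the integral over Y, where it is at most
the mean dimension of a fibre; ν has total mass 1.

Three facts carry this. `exists_quasitiling`: sets T with φ(T)/|T| small, laid greedily with small
overlaps, exhaust almost all of any sufficiently invariant F, so a small lower limit of φ(F)/|F|
forces a small upper limit. `coverDim_le_add`: D is subadditive under joins, proved by cutting bump
functions of two covers at a common level. `eventually_coverDim_restrictCover_le`: D on fibres is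
upper semicontinuous in the base point, so the integrand is Borel. -/

theorem almostInvariant_mem_invariantFilter {K : Finset Γ} (hK : K.Nonempty) {δ : ℝ}
    (hδ : 0 < δ) : almostInvariant K δ ∈ invariantFilter Γ :=
  mem_iInf_of_mem K <| mem_iInf_of_mem hK <| mem_iInf_of_mem δ <| mem_iInf_of_mem hδ <|
    mem_principal_self _

theorem almostInvariant_anti {K L : Finset Γ} (h : K ⊆ L) {δ δ' : ℝ} (hδ : δ ≤ δ') :
    almostInvariant L δ ⊆ almostInvariant K δ' := by
  rintro F ⟨hF, hc⟩
  refine ⟨hF, ?_⟩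
  have h1 : (({t | t ∈ F ∧ ∀ k ∈ L, k * t ∈ F} : Set Γ).ncard : ℝ) ≤
      (({t | t ∈ F ∧ ∀ k ∈ K, k * t ∈ F} : Set Γ).ncard : ℝ) := by
    refine Nat.cast_le.2 (Set.ncard_le_ncard (fun t ht => ⟨ht.1, fun k hk => ht.2 k (h hk)⟩) ?_)
    exact F.finite_toSet.subset fun t ht => ht.1
  have h2 : (0 : ℝ) ≤ F.card := Nat.cast_nonneg _
  nlinarith

variable [DecidableEq Γ]

theorem card_filter_exit_le {K F : Finset Γ} {δ : ℝ} (hF : F ∈ almostInvariant K δ) :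
    ((F.filter fun t => ¬ ∀ k ∈ K, k * t ∈ F).card : ℝ) ≤ δ * F.card := by
  have h := hF.2
  have h1 : ({t | t ∈ F ∧ ∀ k ∈ K, k * t ∈ F} : Set Γ)
      = ((F.filter fun t => ∀ k ∈ K, k * t ∈ F : Finset Γ) : Set Γ) := by
    ext t; simp
  rw [h1, Set.ncard_coe_finset] at h
  have h2 := F.card_filter_add_card_filter_not (fun t => ∀ k ∈ K, k * t ∈ F)
  have h3 : ((F.filter fun t => ∀ k ∈ K, k * t ∈ F).card : ℝ) +
    ((F.filter fun t => ¬ ∀ k ∈ K, k * t ∈ F).card : ℝ) = F.card := by exact_mod_cast h2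
  linarith

theorem mul_singleton_eq_image (A : Finset Γ) (c : Γ) : A * {c} = A.image (· * c) := by
  ext x
  simp only [Finset.mem_mul, Finset.mem_singleton, exists_eq_left, Finset.mem_image]

/-- The outer `S`-boundary of a finite set: the points `c ∉ P` with `S c ∩ P ≠ ∅`. -/
def outerBoundary (S P : Finset Γ) : Finset Γ := (S⁻¹ * P) \ P

theorem mem_outerBoundary {S P : Finset Γ} {c : Γ} :
    c ∈ outerBoundary S P ↔ (∃ s ∈ S, s * c ∈ P) ∧ c ∉ P := by
  simp only [outerBoundary, Finset.mem_sdiff, Finset.mem_mul, Finset.mem_inv]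
  refine and_congr_left fun _ => ⟨?_, ?_⟩
  · rintro ⟨_, ⟨s, hs, rfl⟩, p, hp, rfl⟩
    exact ⟨s, hs, by simpa using hp⟩
  · rintro ⟨s, hs, h⟩
    exact ⟨s⁻¹, ⟨s, hs, rfl⟩, s * c, h, by simp⟩

theorem card_outerBoundary_union_le (S P Q : Finset Γ) :
    (outerBoundary S (P ∪ Q)).card ≤ (outerBoundary S P).card + (outerBoundary S Q).card := by
  refine (Finset.card_le_card ?_).trans (Finset.card_union_le _ _)
  intro c
  simp only [Finset.mem_union, mem_outerBoundary]
  rintro ⟨⟨s, hs, h | h⟩, hc⟩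
  · exact Or.inl ⟨⟨s, hs, h⟩, fun h' => hc (Or.inl h')⟩
  · exact Or.inr ⟨⟨s, hs, h⟩, fun h' => hc (Or.inr h')⟩

theorem card_outerBoundary_mul_singleton (S P : Finset Γ) (c : Γ) :
    (outerBoundary S (P * {c})).card = (outerBoundary S P).card := by
  rw [outerBoundary, outerBoundary, ← mul_assoc, mul_singleton_eq_image, mul_singleton_eq_image,
    ← Finset.image_sdiff _ _ (mul_left_injective c),
    Finset.card_image_of_injective _ (mul_left_injective c)]

theorem card_outerBoundary_mono {S S' : Finset Γ} (h : S ⊆ S') (P : Finset Γ) :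
    (outerBoundary S P).card ≤ (outerBoundary S' P).card := by
  refine Finset.card_le_card fun c => ?_
  simp only [mem_outerBoundary]
  rintro ⟨⟨s, hs, h'⟩, hc⟩
  exact ⟨⟨s, h hs, h'⟩, hc⟩

/-- If c ∉ T and s c ∈ T, then s⁻¹ carries s c out of T. So each boundary point is s⁻¹ times a point
that exits T under S⁻¹, and each exit point accounts for at most |S| of them. -/
theorem card_outerBoundary_le {S T : Finset Γ} {δ : ℝ} (hT : T ∈ almostInvariant S⁻¹ δ) :
    ((outerBoundary S T).card : ℝ) ≤ S.card * (δ * T.card) := by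
  have h1 : outerBoundary S T ⊆
      S.biUnion fun s => (T.filter fun t => ¬ ∀ k ∈ S⁻¹, k * t ∈ T).image (s⁻¹ * ·) := by
    intro c
    simp only [mem_outerBoundary, Finset.mem_biUnion, Finset.mem_image, Finset.mem_filter]
    rintro ⟨⟨s, hs, h⟩, hc⟩
    refine ⟨s, hs, s * c, ⟨h, fun H => hc ?_⟩, by simp⟩
    simpa using H s⁻¹ (Finset.inv_mem_inv hs)
  have h2 : ((outerBoundary S T).card : ℝ) ≤
      ∑ s ∈ S, ((T.filter fun t => ¬ ∀ k ∈ S⁻¹, k * t ∈ T).card : ℝ) := by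
    refine (Nat.cast_le.2 ((Finset.card_le_card h1).trans Finset.card_biUnion_le)).trans ?_
    push_cast
    exact Finset.sum_le_sum fun s _ => Nat.cast_le.2 Finset.card_image_le
  refine h2.trans ?_
  rw [Finset.sum_const, nsmul_eq_mul]
  exact mul_le_mul_of_nonneg_left (card_filter_exit_le hT) (Nat.cast_nonneg _)

/-- Greedy filling of `F` by almost disjoint right translates of `T`. -/
theorem exists_greedy_filling {ε : ℝ} (hε1 : ε < 1) {T F P : Finset Γ}
    (hT : T.Nonempty) (hPF : P ⊆ F) :
    ∃ Q : Finset Γ, P ⊆ Q ∧ Q ⊆ F ∧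
      (∀ (ψ : Finset Γ → ℝ) (κ : ℝ), (∀ A B, ψ (A ∪ B) ≤ ψ A + ψ B) →
        (∀ A s, ψ (A * {s}) = ψ A) → 0 ≤ κ → ψ T ≤ κ * ((1 - ε) * T.card) →
        ψ Q ≤ ψ P + κ * ((Q.card : ℝ) - P.card)) ∧
      ∀ c, T * {c} ⊆ F → ε * T.card < ((T * {c} ∩ Q).card : ℝ) := by
  classical
  -- The bound is kept for all ψ and κ at once, because the same Q must later serve both φ and the
  -- boundary count. Take Q of maximal size: a translate of T inside F meeting Q in at most ε|T|
  -- points could still be added.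
  let good : Finset Γ → Prop := fun Q => P ⊆ Q ∧
      (∀ (ψ : Finset Γ → ℝ) (κ : ℝ), (∀ A B, ψ (A ∪ B) ≤ ψ A + ψ B) →
        (∀ A s, ψ (A * {s}) = ψ A) → 0 ≤ κ → ψ T ≤ κ * ((1 - ε) * T.card) →
        ψ Q ≤ ψ P + κ * ((Q.card : ℝ) - P.card))
  have hP : P ∈ F.powerset.filter good :=
    Finset.mem_filter.2 ⟨Finset.mem_powerset.2 hPF, subset_rfl, fun ψ κ _ _ _ _ => by
      rw [sub_self, mul_zero, add_zero]⟩
  obtain ⟨Q, hQ, hmax⟩ := (F.powerset.filter good).exists_max_image Finset.card ⟨P, hP⟩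
  obtain ⟨hQF', hPQ, hQψ⟩ := Finset.mem_filter.1 hQ
  have hQF := Finset.mem_powerset.1 hQF'
  refine ⟨Q, hPQ, hQF, hQψ, fun c hc => ?_⟩
  by_contra! hsmall
  have hcard : ((Q ∪ T * {c}).card : ℝ) + ((T * {c} ∩ Q).card : ℝ) = Q.card + T.card := by
    have := Finset.card_union_add_card_inter Q (T * {c})
    rw [Finset.inter_comm, Finset.card_mul_singleton] at this
    exact_mod_cast this
  have hTpos : (0 : ℝ) < T.card := Nat.cast_pos.2 hT.card_pos
  have hgrow : (1 - ε) * T.card ≤ ((Q ∪ T * {c}).card : ℝ) - Q.card := by linarith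
  have hgood : good (Q ∪ T * {c}) := by
    refine ⟨hPQ.trans Finset.subset_union_left, fun ψ κ hsub hinv hκ hψT => ?_⟩
    have h1 := hsub Q (T * {c})
    rw [hinv] at h1
    have h2 := hQψ ψ κ hsub hinv hκ hψT
    have h3 := mul_le_mul_of_nonneg_left hgrow hκ
    have h4 : ψ P + κ * ((Q.card : ℝ) - P.card) + κ * (((Q ∪ T * {c}).card : ℝ) - Q.card) =
      ψ P + κ * (((Q ∪ T * {c}).card : ℝ) - P.card) := by ring
    exact h1.trans ((add_le_add h2 (hψT.trans h3)).trans h4.le)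
  have hle' : ((Q ∪ T * {c}).card : ℝ) ≤ Q.card :=
    Nat.cast_le.2 (hmax _ (Finset.mem_filter.2
      ⟨Finset.mem_powerset.2 (Finset.union_subset hQF hc), hgood⟩))
  have := mul_pos (sub_pos.2 hε1) hTpos
  linarith

/-- Double counting of the pairs (t, c) with t c ∈ Q: each c gives at least ε|T| of them, each t at
most |Q|. -/
theorem mul_card_filter_le {ε : ℝ} {T C Q : Finset Γ} (hT : T.Nonempty)
    (h : ∀ c ∈ C, ε * T.card ≤ ((T * {c} ∩ Q).card : ℝ)) : ε * C.card ≤ Q.card := by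
  have hTpos : (0 : ℝ) < T.card := Nat.cast_pos.2 hT.card_pos
  have h1 : ∀ c, (T * {c} ∩ Q).card ≤ ∑ t ∈ T, if t * c ∈ Q then 1 else 0 := by
    intro c
    rw [← Finset.card_filter]
    refine (Finset.card_le_card ?_).trans
      (Finset.card_image_le (s := T.filter fun t => t * c ∈ Q) (f := (· * c)))
    intro x
    simp only [Finset.mem_inter, mul_singleton_eq_image, Finset.mem_image, Finset.mem_filter]
    rintro ⟨⟨t, ht, rfl⟩, hx⟩
    exact ⟨t, ⟨ht, hx⟩, rfl⟩
  have h2 : ∑ c ∈ C, (T * {c} ∩ Q).card ≤ T.card * Q.card := by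
    refine (Finset.sum_le_sum fun c _ => h1 c).trans ?_
    rw [Finset.sum_comm, ← smul_eq_mul, ← Finset.sum_const]
    refine Finset.sum_le_sum fun t _ => ?_
    rw [← Finset.card_filter]
    refine Finset.card_le_card_of_injOn (t * ·) (fun c hc => ?_) (mul_right_injective t).injOn
    simpa using (Finset.mem_filter.1 hc).2
  have h3 : ∑ c ∈ C, ε * (T.card : ℝ) ≤ T.card * Q.card := by
    refine (Finset.sum_le_sum h).trans ?_
    exact_mod_cast h2
  rw [Finset.sum_const, nsmul_eq_mul] at h3
  refine le_of_mul_le_mul_left ?_ hTpos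
  linarith

/-- Quasitiling: sufficiently invariant sets are filled, up to a small proportion, by almost
disjoint right translates of sets on which `φ` is small. -/
theorem exists_quasitiling (φ : Finset Γ → ℝ) (hφ0 : φ ∅ ≤ 0)
    (hsub : ∀ A B, φ (A ∪ B) ≤ φ A + φ B) (hinv : ∀ A s, φ (A * {s}) = φ A)
    {κ ε η : ℝ} (hκ : 0 ≤ κ) (hε0 : 0 < ε) (hε1 : ε < 1) (hη : 0 < η)
    (hfreq : ∃ᶠ T in invariantFilter Γ, φ T ≤ κ * ((1 - ε) * T.card)) (n : ℕ) :
    ∀ S : Finset Γ, S.Nonempty → ∃ K : Finset Γ, K.Nonempty ∧ ∃ δ : ℝ, 0 < δ ∧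
      ∀ F ∈ almostInvariant K δ, ∃ P ⊆ F,
        ((F \ P).card : ℝ) ≤ ((1 - ε) ^ n + 2 * η) * F.card ∧ φ P ≤ κ * P.card ∧
        ((outerBoundary S P).card : ℝ) ≤ η * P.card := by
  induction n with
  | zero =>
    intro S hS
    refine ⟨S, hS, 1, one_pos, fun F _ => ⟨∅, by simp, ?_, by simpa using hφ0, ?_⟩⟩
    · simp only [Finset.sdiff_empty, pow_zero]
      nlinarith [(Nat.cast_nonneg F.card : (0 : ℝ) ≤ F.card)]
    · simp [outerBoundary]
  | succ n ih =>
    intro S hS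
    have hSpos : (0 : ℝ) < S.card := Nat.cast_pos.2 hS.card_pos
    -- The division by |S| cancels the factor |S| in `card_outerBoundary_le`.
    have hδ' : 0 < η * (1 - ε) / S.card := div_pos (mul_pos hη (sub_pos.2 hε1)) hSpos
    obtain ⟨T, hTφ, hTinv⟩ := (hfreq.and_eventually
      (almostInvariant_mem_invariantFilter hS.inv hδ')).exists
    have hTS := card_outerBoundary_le hTinv
    have hTS' : ((outerBoundary S T).card : ℝ) ≤ η * ((1 - ε) * T.card) := by
      refine hTS.trans (le_of_eq ?_)
      field_simp
    have hTne : T.Nonempty := hTinv.1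
    -- The tile T is chosen first but laid last: asking for a small (S ∪ T)-boundary makes the part
    -- P covered by the other tiles nearly T-invariant, so T still fits into most of F \ P.
    obtain ⟨K, hK, δ, hδ, H⟩ := ih (S ∪ T) (hS.mono Finset.subset_union_left)
    refine ⟨K ∪ T, hK.mono Finset.subset_union_left, min δ η, lt_min hδ hη, fun F hF => ?_⟩
    obtain ⟨P, hPF, hPcard, hPφ, hPbd⟩ :=
      H F (almostInvariant_anti Finset.subset_union_left (min_le_left _ _) hF)
    have hexit := card_filter_exit_le (almostInvariant_anti
      (Finset.subset_union_right (s₁ := K)) (min_le_right δ η) hF)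
    obtain ⟨Q, hPQ, hQF, hQψ, hQc⟩ := exists_greedy_filling hε1 hTne hPF
    have hFP : ((F \ P).card : ℝ) = F.card - P.card := Finset.cast_card_sdiff hPF
    have hFQ : ((F \ Q).card : ℝ) = F.card - Q.card := Finset.cast_card_sdiff hQF
    have hQP : ((Q \ P).card : ℝ) = Q.card - P.card := Finset.cast_card_sdiff hPQ
    have hPcF : (P.card : ℝ) ≤ F.card := Nat.cast_le.2 (Finset.card_le_card hPF)
    refine ⟨Q, hQF, ?_, ?_, ?_⟩
    -- C misses at most 2η|F| points of F \ P, and Q covers at least ε|C| new ones. Hence the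
    -- uncovered proportion u becomes at most (1 - ε)u + 2εη, which has fixed point 2η.
    · let C := (F \ P).filter fun c => ∀ t ∈ T, t * c ∈ F \ P
      have hC : ε * C.card ≤ ((Q \ P).card : ℝ) := by
        refine mul_card_filter_le hTne fun c hc => ?_
        have hc' := (Finset.mem_filter.1 hc).2
        have hsubc : T * {c} ⊆ F \ P := by
          intro x hx
          rw [mul_singleton_eq_image, Finset.mem_image] at hx
          obtain ⟨t, ht, rfl⟩ := hx
          exact hc' t ht
        have : T * {c} ∩ (Q \ P) = T * {c} ∩ Q := by
          ext x
          simp only [Finset.mem_inter, Finset.mem_sdiff]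
          exact ⟨fun h => ⟨h.1, h.2.1⟩, fun h => ⟨h.1, h.2, (Finset.mem_sdiff.1 (hsubc h.1)).2⟩⟩
        rw [this]
        exact (hQc c (hsubc.trans Finset.sdiff_subset)).le
      have hcover : F \ P ⊆ C ∪ ((F.filter fun t => ¬ ∀ k ∈ T, k * t ∈ F) ∪
          outerBoundary T P) := by
        intro c hc
        by_contra hcon
        simp only [Finset.mem_union, not_or, Finset.mem_filter, C, mem_outerBoundary] at hcon
        obtain ⟨h1, h2, h3⟩ := hcon
        rw [Finset.mem_sdiff] at hc
        refine h1 ⟨Finset.mem_sdiff.2 hc, fun t ht => Finset.mem_sdiff.2 ⟨?_, fun h => ?_⟩⟩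
        · by_contra h
          exact h2 ⟨hc.1, fun H => h (H t ht)⟩
        · exact h3 ⟨⟨t, ht, h⟩, hc.2⟩
      have hcount : ((F \ P).card : ℝ) ≤ C.card +
          ((F.filter fun t => ¬ ∀ k ∈ T, k * t ∈ F).card + (outerBoundary T P).card) := by
        have h1 := (Finset.card_le_card hcover).trans (Finset.card_union_le _ _)
        have h2 := h1.trans (Nat.add_le_add_left (Finset.card_union_le _ _) _)
        exact_mod_cast h2
      have hbT : ((outerBoundary T P).card : ℝ) ≤ η * F.card :=
        ((Nat.cast_le.2 (card_outerBoundary_mono Finset.subset_union_right P)).trans hPbd).trans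
          (mul_le_mul_of_nonneg_left hPcF hη.le)
      have h1 : ((F \ P).card : ℝ) - 2 * η * F.card ≤ C.card := by linarith
      have h2 := mul_le_mul_of_nonneg_left h1 hε0.le
      have h3 := mul_le_mul_of_nonneg_left hPcard (sub_pos.2 hε1).le
      rw [hQP] at hC
      rw [hFQ, pow_succ]
      rw [hFP] at h2 h3
      linarith
    · have := hQψ φ κ hsub hinv hκ hTφ
      linarith
    · have h1 := hQψ (fun A => ((outerBoundary S A).card : ℝ)) η
        (fun A B => by exact_mod_cast card_outerBoundary_union_le S A B)
        (fun A s => by rw [card_outerBoundary_mul_singleton]) hη.le hTS'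
      have h2 : ((outerBoundary S P).card : ℝ) ≤ η * P.card :=
        (Nat.cast_le.2 (card_outerBoundary_mono Finset.subset_union_left P)).trans hPbd
      linarith

/-- The Ornstein–Weiss lemma for nonnegative subadditive right-invariant set functions. -/
theorem exists_tendsto_div_card (φ : Finset Γ → ℝ) (hφ0 : φ ∅ ≤ 0) (hnn : ∀ A, 0 ≤ φ A)
    (hsub : ∀ A B, φ (A ∪ B) ≤ φ A + φ B) (hinv : ∀ A s, φ (A * {s}) = φ A)
    {M : ℝ} (hM : ∀ A, φ A ≤ M * A.card) :
    ∃ c : ℝ, Tendsto (fun F : Finset Γ => φ F / F.card) (invariantFilter Γ) (𝓝 c) := by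
  have hne : ∀ᶠ F in invariantFilter Γ, (0 : ℝ) < (F.card : ℝ) := by
    filter_upwards [almostInvariant_mem_invariantFilter (Finset.singleton_nonempty (1 : Γ))
      one_pos] with F hF
    exact Nat.cast_pos.2 hF.1.card_pos
  refine tendsto_of_no_upcrossings dense_univ ?_ ?_ ?_
  · rintro a - b - hab ⟨hfa, hfb⟩
    have ha : 0 < a := by
      obtain ⟨F, hF⟩ := hfa.exists
      exact lt_of_le_of_lt (div_nonneg (hnn F) (Nat.cast_nonneg _)) hF
    have hM0 : 0 ≤ M := by
      have h1 := (hnn {1}).trans (hM {1})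
      simpa using h1
    -- `κ = a / (1 - ε)` is still well below `b`
    obtain ⟨ε, hε0, hε1, hεb⟩ : ∃ ε : ℝ, 0 < ε ∧ ε < 1 ∧ a / (1 - ε) < (a + b) / 2 := by
      refine ⟨(b - a) / (2 * (a + b)), div_pos (by linarith) (by linarith), ?_, ?_⟩
      · rw [div_lt_one (by linarith)]; linarith
      · have : 1 - (b - a) / (2 * (a + b)) = (3 * a + b) / (2 * (a + b)) := by
          have : a + b ≠ 0 := by linarith
          field_simp
          ring
        rw [this, div_div_eq_mul_div, div_lt_div_iff₀ (by linarith) (by norm_num)]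
        nlinarith [mul_pos ha ha, mul_pos ha (sub_pos.2 hab), mul_pos (sub_pos.2 hab) (sub_pos.2 hab)]
    have hε1' : 0 < 1 - ε := sub_pos.2 hε1
    set κ := a / (1 - ε)
    have hκ : 0 < κ := div_pos ha hε1'
    obtain ⟨η, hη, hηM⟩ : ∃ η : ℝ, 0 < η ∧ M * (3 * η) < (b - a) / 2 := by
      refine ⟨(b - a) / (6 * (M + 1)) / 2, by have : 0 < b - a := sub_pos.2 hab
                                              positivity, ?_⟩
      have h : M * (3 * ((b - a) / (6 * (M + 1)) / 2)) = (M / (M + 1)) * ((b - a) / 4) := by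
        field_simp; ring
      rw [h]
      have h1 : M / (M + 1) ≤ 1 := by rw [div_le_one (by linarith)]; linarith
      nlinarith [sub_pos.2 hab]
    obtain ⟨n, hn⟩ := exists_pow_lt_of_lt_one hη (by linarith : 1 - ε < 1)
    have hfreq : ∃ᶠ T in invariantFilter Γ, φ T ≤ κ * ((1 - ε) * T.card) := by
      refine (hfa.and_eventually hne).mono fun T hT => ?_
      have h1 := (div_lt_iff₀ hT.2).1 hT.1
      have h2 : κ * ((1 - ε) * T.card) = a * T.card := by
        rw [← mul_assoc, div_mul_cancel₀ _ hε1'.ne']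
      linarith
    -- The {1}-boundary is empty, so this choice of S asks nothing of P.
    obtain ⟨K, hK, δ, hδ, H⟩ := exists_quasitiling φ hφ0 hsub hinv hκ.le hε0 hε1 hη hfreq n {1}
      (Finset.singleton_nonempty _)
    refine hfb ?_
    filter_upwards [almostInvariant_mem_invariantFilter hK hδ, hne] with F hF hpos
    obtain ⟨P, hPF, hP1, hP2, -⟩ := H F hF
    rw [not_lt, div_le_iff₀ hpos]
    have h1 := hsub P (F \ P)
    rw [Finset.union_sdiff_of_subset hPF] at h1
    have h2 := hM (F \ P)
    have h3 : ((F \ P).card : ℝ) ≤ (3 * η) * F.card :=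
      hP1.trans (mul_le_mul_of_nonneg_right (by linarith) hpos.le)
    have h4 := mul_le_mul_of_nonneg_left h3 hM0
    have h5 : κ * P.card ≤ κ * F.card :=
      mul_le_mul_of_nonneg_left (Nat.cast_le.2 (Finset.card_le_card hPF)) hκ.le
    have h6 : (κ + M * (3 * η)) * F.card ≤ b * F.card :=
      mul_le_mul_of_nonneg_right (by linarith) hpos.le
    linarith
  · refine isBoundedUnder_of_eventually_le (a := M) ?_
    filter_upwards [hne] with F hF
    exact (div_le_iff₀ hF).2 (hM F)
  · exact isBoundedUnder_of_eventually_ge (a := 0)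
      (Eventually.of_forall fun F => div_nonneg (hnn F) (Nat.cast_nonneg _))

end Quasitiling

/-! ### Følner sequences and the invariance filter -/

section Folner

variable {Γ : Type*} [Group Γ]

theorem IsFolnerSeq.tendsto_invariantFilter {F : ℕ → Finset Γ} (hF : IsFolnerSeq F) :
    Tendsto F atTop (invariantFilter Γ) := by
  classical
  simp only [invariantFilter, tendsto_iInf, tendsto_principal]
  intro K _ δ hδ
  have hsum : Tendsto (fun n => ∑ k ∈ K, (((k • (F n : Set Γ)) ∆ (F n : Set Γ)).ncard : ℝ) /
      ((F n).card : ℝ)) atTop (𝓝 0) := by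
    simpa using tendsto_finsetSum K fun k _ => hF.tendsto k
  filter_upwards [hsum.eventually (gt_mem_nhds hδ)] with n hn
  have hpos : (0 : ℝ) < (F n).card := Nat.cast_pos.2 (hF.nonempty n).card_pos
  refine ⟨hF.nonempty n, ?_⟩
  have h1 : ({t | t ∈ F n ∧ ∀ k ∈ K, k * t ∈ F n} : Set Γ)
      = (((F n).filter fun t => ∀ k ∈ K, k * t ∈ F n : Finset Γ) : Set Γ) := by
    ext t; simp
  rw [h1, Set.ncard_coe_finset]
  have h2 := (F n).card_filter_add_card_filter_not (fun t => ∀ k ∈ K, k * t ∈ F n)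
  have h3 : (((F n).filter fun t => ∀ k ∈ K, k * t ∈ F n).card : ℝ) +
    (((F n).filter fun t => ¬ ∀ k ∈ K, k * t ∈ F n).card : ℝ) = (F n).card := by
    exact_mod_cast h2
  have h4 : (((F n).filter fun t => ¬ ∀ k ∈ K, k * t ∈ F n).card : ℝ) ≤
      ∑ k ∈ K, (((k • (F n : Set Γ)) ∆ (F n : Set Γ)).ncard : ℝ) := by
    have hsub : ((F n).filter fun t => ¬ ∀ k ∈ K, k * t ∈ F n) ⊆
        K.biUnion fun k => (F n).filter fun t => k * t ∉ F n := by
      intro t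
      simp only [Finset.mem_filter, Finset.mem_biUnion, not_forall]
      rintro ⟨ht, k, hk, h⟩
      exact ⟨k, hk, ht, h⟩
    refine (Nat.cast_le.2 ((Finset.card_le_card hsub).trans Finset.card_biUnion_le)).trans ?_
    push_cast
    refine Finset.sum_le_sum fun k _ => Nat.cast_le.2 ?_
    -- Translation by k embeds the points leaving Fₙ under k into k Fₙ \ Fₙ.
    rw [← Finset.card_image_of_injective _ (mul_right_injective k), ← Set.ncard_coe_finset]
    refine Set.ncard_le_ncard (fun x hx => ?_)
      (((F n).finite_toSet.smul_set).symmDiff (F n).finite_toSet)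
    simp only [Finset.coe_image, Set.mem_image, Finset.mem_coe, Finset.mem_filter] at hx
    obtain ⟨t, ⟨ht, h⟩, rfl⟩ := hx
    exact Or.inl ⟨Set.mem_smul_set.2 ⟨t, ht, rfl⟩, h⟩
  rw [← Finset.sum_div, div_lt_iff₀ hpos] at hn
  linarith

end Folner

/-! ### Dimension of covers: subadditivity and semicontinuity -/

section CoverDim

variable {Z Z' : Type*}

theorem ord_le_iff {𝒲 : Set (Set Z)} {k : ℕ∞} :
    ord 𝒲 ≤ k ↔ ∀ z, ({W | W ∈ 𝒲 ∧ z ∈ W} : Set (Set Z)).encard ≤ k + 1 := by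
  rw [ord, tsub_le_iff_right, iSup_le_iff]

theorem encard_setOf_subtype_le {𝒲 : Set (Set Z)} {s : Set 𝒲} {z : Z}
    (h : ∀ i ∈ s, z ∈ (i : Set Z)) :
    s.encard ≤ ({W | W ∈ 𝒲 ∧ z ∈ W} : Set (Set Z)).encard :=
  Set.encard_le_encard_of_injOn (f := Subtype.val) (fun i hi => ⟨i.2, h i hi⟩)
    Subtype.val_injective.injOn

variable [TopologicalSpace Z] [TopologicalSpace Z']

theorem coverDim_le_ord {𝒰 𝒲 : Set (Set Z)} (hc : IsFiniteOpenCover 𝒲) (hr : Refines 𝒲 𝒰) :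
    coverDim 𝒰 ≤ ord 𝒲 := by
  rw [coverDim]
  exact iInf_le_of_le 𝒲 (iInf_le_of_le hc (iInf_le _ hr))

/-- A finite bound on an infimum in `ℕ∞` is achieved by an actual cover; stating it as multiplicity
k + 1 avoids the truncated subtraction in `ord`. -/
theorem coverDim_le_iff {𝒰 : Set (Set Z)} {k : ℕ} :
    coverDim 𝒰 ≤ k ↔ ∃ 𝒲, IsFiniteOpenCover 𝒲 ∧ Refines 𝒲 𝒰 ∧
      ∀ z, ({W | W ∈ 𝒲 ∧ z ∈ W} : Set (Set Z)).encard ≤ k + 1 := by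
  constructor
  · intro h
    have h' : coverDim 𝒰 < (k : ℕ∞) + 1 :=
      (ENat.lt_add_one_iff (ENat.natCast_ne_top k)).2 h
    simp only [coverDim, iInf_lt_iff] at h'
    obtain ⟨𝒲, h1, h2, h3⟩ := h'
    exact ⟨𝒲, h1, h2, ord_le_iff.1 ((ENat.lt_add_one_iff (ENat.natCast_ne_top k)).1 h3)⟩
  · rintro ⟨𝒲, h1, h2, h3⟩
    exact (coverDim_le_ord h1 h2).trans (ord_le_iff.2 h3)

theorem coverDim_le_encard {𝒰 : Set (Set Z)} (h𝒰 : IsFiniteOpenCover 𝒰) :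
    coverDim 𝒰 ≤ 𝒰.encard := by
  refine (coverDim_le_ord h𝒰 fun W hW => ⟨W, hW, subset_rfl⟩).trans
    (ord_le_iff.2 fun z => ?_)
  exact (Set.encard_le_encard fun W hW => hW.1).trans le_self_add

theorem coverDim_lt_top {𝒰 : Set (Set Z)} (h𝒰 : IsFiniteOpenCover 𝒰) : coverDim 𝒰 < ⊤ :=
  (coverDim_le_encard h𝒰).trans_lt (Set.encard_lt_top_iff.2 h𝒰.finite)

/-- The dimension of a cover does not increase under pulling back. -/
theorem coverDim_le_of_preimage_subset {f : Z → Z'} (hf : Continuous f) {𝒰 : Set (Set Z)}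
    {𝒱 : Set (Set Z')} (h : ∀ A ∈ 𝒱, ∃ B ∈ 𝒰, f ⁻¹' A ⊆ B) : coverDim 𝒰 ≤ coverDim 𝒱 := by
  rcases eq_or_ne (coverDim 𝒱) ⊤ with htop | htop
  · rw [htop]; exact le_top
  obtain ⟨k, hk⟩ := ENat.ne_top_iff_exists.1 htop
  rw [← hk]
  obtain ⟨𝒲, hc, hr, ho⟩ := coverDim_le_iff.1 hk.ge
  refine coverDim_le_iff.2 ⟨(f ⁻¹' ·) '' 𝒲, ⟨hc.finite.image _, ?_, ?_⟩, ?_, fun z => ?_⟩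
  · rintro _ ⟨W, hW, rfl⟩
    exact (hc.isOpen W hW).preimage hf
  · refine Set.eq_univ_of_forall fun z => ?_
    obtain ⟨W, hW, hz⟩ := Set.mem_sUnion.1 (hc.sUnion_eq.symm ▸ Set.mem_univ (f z))
    exact Set.mem_sUnion.2 ⟨_, ⟨W, hW, rfl⟩, hz⟩
  · rintro _ ⟨W, hW, rfl⟩
    obtain ⟨A, hA, hWA⟩ := hr W hW
    obtain ⟨B, hB, hAB⟩ := h A hA
    exact ⟨B, hB, (Set.preimage_mono hWA).trans hAB⟩
  · refine (Set.encard_le_encard (t := (f ⁻¹' ·) '' {W | W ∈ 𝒲 ∧ f z ∈ W}) ?_).trans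
      ((Set.encard_image_le _ _).trans (ho (f z)))
    rintro _ ⟨⟨W, hW, rfl⟩, hz⟩
    exact ⟨W, ⟨hW, hz⟩, rfl⟩

/-- Functions adapted to a finite open cover: each is supported in its member of the cover, and
at each point one of them equals `1`. -/
theorem IsFiniteOpenCover.exists_functions [NormalSpace Z] {𝒲 : Set (Set Z)}
    (h : IsFiniteOpenCover 𝒲) :
    ∃ f : 𝒲 → C(Z, ℝ), (∀ i z, 0 < f i z → z ∈ (i : Set Z)) ∧ ∀ z, ∃ i, f i z = 1 := by
  have := h.finite.to_subtype
  obtain ⟨f, hf⟩ := BumpCovering.exists_isSubordinate_of_locallyFinite (s := Set.univ)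
    isClosed_univ (fun i : 𝒲 => (i : Set Z)) (fun i => h.isOpen i i.2) (locallyFinite_of_finite _)
    (by rw [← Set.sUnion_eq_iUnion, h.sUnion_eq])
  refine ⟨fun i => f i, fun i z hz => hf i (subset_tsupport _ hz.ne'), fun z => ?_⟩
  obtain ⟨i, hi⟩ := f.eventuallyEq_one' z (Set.mem_univ z)
  exact ⟨i, hi.self_of_nhds⟩

/-- The points at which some level `t > 0` separates the values of `f` with index in `A` from the
other ones, and likewise for `g` and `B`. -/
def levelSet {ι κ : Type*} (f : ι → C(Z, ℝ)) (g : κ → C(Z, ℝ)) (p : Set ι × Set κ) : Set Z :=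
  {z | ∃ t : ℝ, 0 < t ∧ ((∀ i ∈ p.1, t < f i z) ∧ ∀ i ∉ p.1, f i z < t) ∧
    (∀ j ∈ p.2, t < g j z) ∧ ∀ j ∉ p.2, g j z < t}

theorem isOpen_levelSet {ι κ : Type*} [Finite ι] [Finite κ] (f : ι → C(Z, ℝ)) (g : κ → C(Z, ℝ))
    (p : Set ι × Set κ) : IsOpen (levelSet f g p) := by
  simp only [levelSet, Set.ofPred_exists, Set.ofPred_and, Set.ofPred_forall]
  refine isOpen_iUnion fun t => IsOpen.inter isOpen_const (((?_ : IsOpen _).inter ?_).inter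
    ((?_ : IsOpen _).inter ?_))
  · exact isOpen_iInter_of_finite fun i => isOpen_iInter_of_finite fun _ =>
      isOpen_lt continuous_const (f i).continuous
  · exact isOpen_iInter_of_finite fun i => isOpen_iInter_of_finite fun _ =>
      isOpen_lt (f i).continuous continuous_const
  · exact isOpen_iInter_of_finite fun i => isOpen_iInter_of_finite fun _ =>
      isOpen_lt continuous_const (g i).continuous
  · exact isOpen_iInter_of_finite fun i => isOpen_iInter_of_finite fun _ =>
      isOpen_lt (g i).continuous continuous_const

/-- The index pairs of the level sets containing a point form a chain. -/
theorem injOn_ncard_levelSet {ι κ : Type*} [Finite ι] [Finite κ] (f : ι → C(Z, ℝ))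
    (g : κ → C(Z, ℝ)) (z : Z) :
    Set.InjOn (fun p : Set ι × Set κ => p.1.ncard + p.2.ncard) {p | z ∈ levelSet f g p} := by
  have key : ∀ (A A' : Set ι) (B B' : Set κ) (t t' : ℝ), t ≤ t' →
      (∀ i ∉ A, f i z < t) → (∀ i ∈ A', t' < f i z) →
      (∀ i ∉ B, g i z < t) → (∀ i ∈ B', t' < g i z) →
      A.ncard + B.ncard = A'.ncard + B'.ncard → A' = A ∧ B' = B := by
    intro A A' B B' t t' htt h1 h2 h3 h4 hcard
    have hA : A' ⊆ A := fun i hi => by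
      by_contra hn
      linarith [h1 i hn, h2 i hi]
    have hB : B' ⊆ B := fun i hi => by
      by_contra hn
      linarith [h3 i hn, h4 i hi]
    have hA' := Set.ncard_le_ncard hA
    have hB' := Set.ncard_le_ncard hB
    exact ⟨Set.eq_of_subset_of_ncard_le hA (by omega), Set.eq_of_subset_of_ncard_le hB (by omega)⟩
  rintro ⟨A, B⟩ ⟨t, -, ⟨h1, h2⟩, h3, h4⟩ ⟨A', B'⟩ ⟨t', -, ⟨h1', h2'⟩, h3', h4'⟩ hcard
  simp only at h1 h2 h3 h4 h1' h2' h3' h4' hcard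
  rcases le_total t t' with htt | htt
  · obtain ⟨rfl, rfl⟩ := key A A' B B' t t' htt h2 h1' h4 h3' hcard
    rfl
  · obtain ⟨rfl, rfl⟩ := key A' A B' B t' t htt h2' h1 h4' h3 hcard.symm
    rfl

/-- Subadditivity of the dimension of covers under joins. -/
theorem coverDim_le_add [NormalSpace Z] {𝒰 𝒱 𝒯 : Set (Set Z)}
    (h : ∀ U ∈ 𝒰, ∀ V ∈ 𝒱, ∃ T ∈ 𝒯, U ∩ V ⊆ T) : coverDim 𝒯 ≤ coverDim 𝒰 + coverDim 𝒱 := by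
  rcases eq_or_ne (coverDim 𝒰) ⊤ with htop | htop
  · rw [htop, top_add]; exact le_top
  rcases eq_or_ne (coverDim 𝒱) ⊤ with htop' | htop'
  · rw [htop', add_top]; exact le_top
  obtain ⟨k, hk⟩ := ENat.ne_top_iff_exists.1 htop
  obtain ⟨l, hl⟩ := ENat.ne_top_iff_exists.1 htop'
  obtain ⟨𝒜, hAc, hAr, hAo⟩ := coverDim_le_iff.1 hk.ge
  obtain ⟨ℬ, hBc, hBr, hBo⟩ := coverDim_le_iff.1 hl.ge
  obtain ⟨f, hf0, hf1⟩ := hAc.exists_functions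
  obtain ⟨g, hg0, hg1⟩ := hBc.exists_functions
  have := hAc.finite.to_subtype
  have := hBc.finite.to_subtype
  rw [← hk, ← hl, ← Nat.cast_add]
  let I : Set (Set 𝒜 × Set ℬ) := {p | p.1.Nonempty ∧ p.2.Nonempty}
  refine coverDim_le_iff.2 ⟨levelSet f g '' I, ⟨I.toFinite.image _, ?_, ?_⟩, ?_, fun z => ?_⟩
  · rintro _ ⟨p, -, rfl⟩
    exact isOpen_levelSet f g p
  · refine Set.eq_univ_of_forall fun z => ?_
    -- A level below 1 makes both index sets nonempty; avoiding the finitely many values at z makes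
    -- all inequalities strict.
    obtain ⟨t, ht, htn⟩ := (Set.Ioo_infinite (zero_lt_one' ℝ)).exists_notMem_finite
      ((Set.finite_range fun i => f i z).union (Set.finite_range fun j => g j z))
    simp only [Set.mem_union, Set.mem_range, not_or, not_exists] at htn
    obtain ⟨i, hi⟩ := hf1 z
    obtain ⟨j, hj⟩ := hg1 z
    refine Set.mem_sUnion.2 ⟨levelSet f g ({i | t < f i z}, {j | t < g j z}),
      ⟨_, ⟨⟨i, ?_⟩, j, ?_⟩, rfl⟩, t, ht.1, ⟨fun i hi => hi, fun i hi => ?_⟩,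
        fun i hi => hi, fun i hi => ?_⟩
    · exact (hi.symm ▸ ht.2 : t < f i z)
    · exact (hj.symm ▸ ht.2 : t < g j z)
    · exact lt_of_le_of_ne (not_lt.1 hi) (htn.1 i)
    · exact lt_of_le_of_ne (not_lt.1 hi) (htn.2 i)
  · rintro _ ⟨⟨A, B⟩, ⟨⟨i, hi⟩, ⟨j, hj⟩⟩, rfl⟩
    obtain ⟨U, hU, hiU⟩ := hAr i i.2
    obtain ⟨V, hV, hjV⟩ := hBr j j.2
    obtain ⟨T, hT, hUV⟩ := h U hU V hV
    refine ⟨T, hT, ?_⟩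
    rintro z ⟨t, ht, ⟨h1, -⟩, h3, -⟩
    exact hUV ⟨hiU (hf0 i z (ht.trans (h1 i hi))), hjV (hg0 j z (ht.trans (h3 j hj)))⟩
  · have hsub : {W | W ∈ levelSet f g '' I ∧ z ∈ W} ⊆
        levelSet f g '' (I ∩ {p | z ∈ levelSet f g p}) := by
      rintro _ ⟨⟨p, hp, rfl⟩, hz⟩
      exact ⟨p, ⟨hp, hz⟩, rfl⟩
    refine (Set.encard_le_encard hsub).trans ((Set.encard_image_le _ _).trans ?_)
    -- Along the chain of pairs at z, |A| + |B| is injective. Nonemptiness of both sets makes it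
    -- start at 2 rather than 1, leaving k + l + 1 values, hence order k + l.
    have hmaps : ∀ p ∈ I ∩ {p | z ∈ levelSet f g p},
        p.1.ncard + p.2.ncard ∈ (Finset.Icc 2 (k + l + 2) : Set ℕ) := by
      rintro ⟨A, B⟩ ⟨⟨hA, hB⟩, t, ht, ⟨h1, -⟩, h3, -⟩
      have hA1 := (Set.ncard_pos (s := A)).2 hA
      have hB1 := (Set.ncard_pos (s := B)).2 hB
      have hA2 : A.ncard ≤ k + 1 := by
        have := (encard_setOf_subtype_le fun i hi => hf0 i z (ht.trans (h1 i hi))).trans (hAo z)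
        rw [← A.toFinite.cast_ncard_eq] at this
        exact_mod_cast this
      have hB2 : B.ncard ≤ l + 1 := by
        have := (encard_setOf_subtype_le fun i hi => hg0 i z (ht.trans (h3 i hi))).trans (hBo z)
        rw [← B.toFinite.cast_ncard_eq] at this
        exact_mod_cast this
      simp only [Finset.coe_Icc, Set.mem_Icc]
      omega
    refine (Set.encard_le_encard_of_injOn hmaps
      ((injOn_ncard_levelSet f g z).mono Set.inter_subset_right)).trans ?_
    rw [Set.encard_coe_eq_coe_finsetCard, Nat.card_Icc]
    exact_mod_cast (by omega)

/-- Upper semicontinuity of the dimension of a cover along the fibres of a map. -/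
theorem eventually_coverDim_restrictCover_le {X Y : Type*} [TopologicalSpace X] [CompactSpace X]
    [T2Space X] [TopologicalSpace Y] [T2Space Y] {π : X → Y} (hπ : Continuous π)
    {𝒰 : Set (Set X)} (h𝒰 : ∀ U ∈ 𝒰, IsOpen U) (y : Y) :
    ∀ᶠ y' in 𝓝 y, coverDim (restrictCover 𝒰 (π ⁻¹' {y'})) ≤
      coverDim (restrictCover 𝒰 (π ⁻¹' {y})) := by
  rcases eq_or_ne (coverDim (restrictCover 𝒰 (π ⁻¹' {y}))) ⊤ with htop | htop
  · simp [htop]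
  obtain ⟨k, hk⟩ := ENat.ne_top_iff_exists.1 htop
  obtain ⟨𝒲, hc, hr, ho⟩ := coverDim_le_iff.1 hk.ge
  have hclosed : IsClosed (π ⁻¹' {y}) := isClosed_singleton.preimage hπ
  have : CompactSpace (π ⁻¹' {y}) := isCompact_iff_compactSpace.1 hclosed.isCompact
  have := hc.finite.to_subtype
  obtain ⟨f, hf0, hf1⟩ := hc.exists_functions
  choose g hg using fun i => ContinuousMap.exists_restrict_eq hclosed (f i)
  have hgf : ∀ i (x : π ⁻¹' {y}), g i x = f i x := fun i x => by
    rw [← hg i]; rfl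
  have hU : ∀ i : 𝒲, ∃ U ∈ 𝒰, (i : Set (π ⁻¹' {y})) ⊆ Subtype.val ⁻¹' U := fun i => by
    obtain ⟨_, ⟨U, hU, rfl⟩, h⟩ := hr i i.2
    exact ⟨U, hU, h⟩
  choose U hU𝒰 hWU using hU
  -- The Tietze extensions g are cut at 1/2, strictly between 0 and 1. Near a fibre point x, O i can
  -- occur only if g i x ≥ 1/2, hence only if x lies in the i-th member of 𝒲, so multiplicity does
  -- not grow; where g i x = 1 the set O i still covers.
  let O : 𝒲 → Set X := fun i => {x | 1 / 2 < g i x} ∩ U i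
  have hO : ∀ i, IsOpen (O i) := fun i =>
    (isOpen_lt continuous_const (g i).continuous).inter (h𝒰 _ (hU𝒰 i))
  have hev : ∀ x ∈ π ⁻¹' {y}, ∀ᶠ x' in 𝓝 x,
      (∃ i, x' ∈ O i) ∧ {i | x' ∈ O i}.encard ≤ (k : ℕ∞) + 1 := by
    intro x hx
    have h1 : ∀ᶠ x' in 𝓝 x, ∃ i, x' ∈ O i := by
      obtain ⟨i, hi⟩ := hf1 ⟨x, hx⟩
      have hxi : x ∈ O i := by
        refine ⟨?_, hWU i (hf0 i ⟨x, hx⟩ (by rw [hi]; exact one_pos))⟩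
        have := hgf i ⟨x, hx⟩
        simp only [Set.mem_ofPred_eq]
        rw [this, hi]; norm_num
      filter_upwards [(hO i).mem_nhds hxi] with x' hx'
      exact ⟨i, hx'⟩
    have h2 : ∀ᶠ x' in 𝓝 x, ∀ i, g i x < 1 / 2 → g i x' < 1 / 2 := by
      refine eventually_all.2 fun i => ?_
      by_cases hi : g i x < 1 / 2
      · filter_upwards [(g i).continuous.continuousAt.eventually (gt_mem_nhds hi)] with x' hx' _
        exact hx'
      · exact Eventually.of_forall fun _ h => absurd h hi
    filter_upwards [h1, h2] with x' h1 h2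
    refine ⟨h1, (encard_setOf_subtype_le (z := ⟨x, hx⟩) fun i hi => hf0 i _ ?_).trans
      (ho ⟨x, hx⟩)⟩
    rw [← hgf]
    by_contra hcon
    have h3 : g i x < 1 / 2 := lt_of_le_of_lt (not_lt.1 hcon) (by norm_num)
    exact lt_asymm (h2 i h3) hi.1
  -- Tube argument: π is closed, so a property holding near every point of a fibre holds on all
  -- nearby fibres.
  filter_upwards [hπ.isClosedMap.eventually_nhds_fiber y hev] with y' hy'
  rw [← hk]
  refine coverDim_le_iff.2 ⟨Set.range fun i => (Subtype.val ⁻¹' O i : Set (π ⁻¹' {y'})),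
    ⟨Set.finite_range _, ?_, ?_⟩, ?_, fun z => ?_⟩
  · rintro _ ⟨i, rfl⟩
    exact (hO i).preimage continuous_subtype_val
  · refine Set.eq_univ_of_forall fun z => ?_
    obtain ⟨i, hi⟩ := (hy' z z.2).1
    exact Set.mem_sUnion.2 ⟨_, ⟨i, rfl⟩, hi⟩
  · rintro _ ⟨i, rfl⟩
    exact ⟨_, ⟨U i, hU𝒰 i, rfl⟩, fun z hz => hz.2⟩
  · refine (Set.encard_le_encard (t := (fun i => (Subtype.val ⁻¹' O i : Set (π ⁻¹' {y'}))) ''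
      {i | (z : X) ∈ O i}) ?_).trans ((Set.encard_image_le _ _).trans (hy' z z.2).2)
    rintro _ ⟨⟨i, rfl⟩, hz⟩
    exact ⟨i, hz, rfl⟩

end CoverDim

/-! ### Iterated covers under the group action -/

section Dynamics

variable {Γ X Y : Type*} [Group Γ] [TopologicalSpace X] [MulAction Γ X]

theorem isOpen_of_mem_coverPow [ContinuousConstSMul Γ X] {𝒰 : Set (Set X)}
    (h𝒰 : ∀ U ∈ 𝒰, IsOpen U) (E : Finset Γ) :
    ∀ A ∈ coverPow 𝒰 E, IsOpen A := by
  rintro _ ⟨U, hU, rfl⟩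
  exact isOpen_biInter_finset fun s hs => (h𝒰 _ (hU s hs)).preimage (continuous_const_smul s)

theorem coverDim_restrictCover_coverPow_empty (𝒰 : Set (Set X)) (K : Set X) :
    coverDim (restrictCover (coverPow 𝒰 (∅ : Finset Γ)) K) = 0 := by
  refine nonpos_iff_eq_zero.1 ?_
  refine (coverDim_le_iff (k := 0)).2 ⟨{Set.univ}, ⟨Set.finite_singleton _, ?_, ?_⟩, ?_,
    fun z => ?_⟩
  · rintro _ rfl
    exact isOpen_univ
  · simp
  · rintro _ rfl
    exact ⟨_, ⟨Set.univ, ⟨fun _ => Set.univ, by simp, by simp⟩, rfl⟩, by simp⟩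
  · refine (Set.encard_le_encard (t := {Set.univ}) fun W hW => hW.1).trans ?_
    simp

theorem coverDim_restrictCover_coverPow_union_le [DecidableEq Γ] (𝒰 : Set (Set X)) (K : Set X)
    [NormalSpace K] (A B : Finset Γ) :
    coverDim (restrictCover (coverPow 𝒰 (A ∪ B)) K) ≤
      coverDim (restrictCover (coverPow 𝒰 A) K) + coverDim (restrictCover (coverPow 𝒰 B) K) := by
  refine coverDim_le_add ?_
  rintro _ ⟨_, ⟨U, hU, rfl⟩, rfl⟩ _ ⟨_, ⟨V, hV, rfl⟩, rfl⟩
  -- On the overlap A ∩ B the constraint coming from V is simply dropped.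
  refine ⟨_, ⟨_, ⟨fun s => if s ∈ A then U s else V s, fun s hs => ?_, rfl⟩, rfl⟩, ?_⟩
  · by_cases h : s ∈ A
    · simpa [h] using hU s h
    · simpa [h] using hV s ((Finset.mem_union.1 hs).resolve_left h)
  · rintro z ⟨h1, h2⟩
    simp only [Set.mem_preimage, Set.mem_iInter] at h1 h2 ⊢
    intro s hs
    by_cases h : s ∈ A
    · simpa [h] using h1 s h
    · simpa [h] using h2 s ((Finset.mem_union.1 hs).resolve_left h)

theorem coverDim_restrictCover_coverPow_singleton_le [ContinuousConstSMul Γ X] (𝒰 : Set (Set X))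
    (K : Set X) (s : Γ) :
    coverDim (restrictCover (coverPow 𝒰 {s}) K) ≤ coverDim 𝒰 := by
  refine coverDim_le_of_preimage_subset (f := fun x : K => s • (x : X))
    ((continuous_const_smul s).comp continuous_subtype_val) fun U hU => ?_
  exact ⟨_, ⟨_, ⟨fun _ => U, fun _ _ => hU, rfl⟩, rfl⟩, fun z hz => by simpa using hz⟩

theorem coverDim_restrictCover_coverPow_le [ContinuousConstSMul Γ X] (𝒰 : Set (Set X))
    (K : Set X) [NormalSpace K]
    (A : Finset Γ) :
    coverDim (restrictCover (coverPow 𝒰 A) K) ≤ A.card * coverDim 𝒰 := by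
  classical
  induction A using Finset.induction_on with
  | empty => simp [coverDim_restrictCover_coverPow_empty]
  | insert s A hs ih =>
    rw [Finset.card_insert_of_notMem hs, Finset.insert_eq]
    refine (coverDim_restrictCover_coverPow_union_le 𝒰 K {s} A).trans ?_
    rw [Nat.cast_add, Nat.cast_one, add_mul, one_mul, add_comm]
    exact add_le_add ih (coverDim_restrictCover_coverPow_singleton_le 𝒰 K s)

variable [MulAction Γ Y] {π : X → Y}

/-- By equivariance, x ↦ s x maps the fibre over y into the fibre over s y, and it pulls a⁻¹U back
to (a s)⁻¹U. Applied to s⁻¹ as well, this gives equality. -/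
theorem coverDim_fiber_coverPow_mul_singleton_le [ContinuousConstSMul Γ X] [DecidableEq Γ]
    (hπ : ∀ (s : Γ) (x : X), π (s • x) = s • π x) (𝒰 : Set (Set X)) (A : Finset Γ) (s : Γ)
    (y : Y) :
    coverDim (restrictCover (coverPow 𝒰 (A * {s})) (π ⁻¹' {y})) ≤
      coverDim (restrictCover (coverPow 𝒰 A) (π ⁻¹' {s • y})) := by
  have hmem : ∀ x : π ⁻¹' {y}, s • (x : X) ∈ π ⁻¹' {s • y} := fun x => by
    have hx : π x = y := x.2
    simp [hπ, hx]
  refine coverDim_le_of_preimage_subset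
    (f := fun x : π ⁻¹' {y} => (⟨s • (x : X), hmem x⟩ : π ⁻¹' {s • y}))
    (((continuous_const_smul s).comp continuous_subtype_val).subtype_mk _) ?_
  rintro _ ⟨_, ⟨U, hU, rfl⟩, rfl⟩
  refine ⟨_, ⟨_, ⟨fun b => U (b * s⁻¹), fun b hb => ?_, rfl⟩, rfl⟩, fun z hz => ?_⟩
  · rw [mul_singleton_eq_image, Finset.mem_image] at hb
    obtain ⟨a, ha, rfl⟩ := hb
    simpa using hU a ha
  · simp only [Set.mem_preimage, Set.mem_iInter] at hz ⊢
    intro b hb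
    rw [mul_singleton_eq_image, Finset.mem_image] at hb
    obtain ⟨a, ha, rfl⟩ := hb
    simpa [mul_smul] using hz a ha

theorem coverDim_fiber_coverPow_mul_singleton [ContinuousConstSMul Γ X] [DecidableEq Γ]
    (hπ : ∀ (s : Γ) (x : X), π (s • x) = s • π x) (𝒰 : Set (Set X)) (A : Finset Γ) (s : Γ)
    (y : Y) :
    coverDim (restrictCover (coverPow 𝒰 (A * {s})) (π ⁻¹' {y})) =
      coverDim (restrictCover (coverPow 𝒰 A) (π ⁻¹' {s • y})) := by
  refine le_antisymm (coverDim_fiber_coverPow_mul_singleton_le hπ 𝒰 A s y) ?_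
  have h := coverDim_fiber_coverPow_mul_singleton_le hπ 𝒰 (A * {s}) s⁻¹ (s • y)
  rwa [inv_smul_smul, mul_assoc, Finset.singleton_mul_singleton, mul_inv_cancel,
    Finset.singleton_one, mul_one] at h

end Dynamics

/-! ### Integration over the base and the inequality -/

section MeanDimensionGiven

variable {Γ X Y : Type*} [Group Γ] [TopologicalSpace X] [CompactSpace X] [T2Space X]
  [TopologicalSpace Y] [T2Space Y] {π : X → Y}

theorem normalSpace_fiber (hπ : Continuous π) (y : Y) : NormalSpace (π ⁻¹' {y}) := by
  have : CompactSpace (π ⁻¹' {y}) :=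
    isCompact_iff_compactSpace.1 (isClosed_singleton.preimage hπ).isCompact
  infer_instance

variable [MeasurableSpace Y] [BorelSpace Y]

/-- Upper semicontinuous functions are Borel. -/
theorem measurable_coverDim_fiber (hπ : Continuous π) {𝒰 : Set (Set X)}
    (h𝒰 : ∀ U ∈ 𝒰, IsOpen U) :
    Measurable fun y => (coverDim (restrictCover 𝒰 (π ⁻¹' {y})) : ℝ≥0∞) := by
  refine UpperSemicontinuous.measurable fun y a ha => ?_
  filter_upwards [eventually_coverDim_restrictCover_le hπ h𝒰 y] with y' hy'
  exact (ENat.toENNReal_le.2 hy').trans_lt ha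

variable [MulAction Γ X] [ContinuousConstSMul Γ X]

theorem coverDim_fiber_coverPow_le (hπ : Continuous π) (𝒰 : Set (Set X)) (A : Finset Γ) (y : Y) :
    (coverDim (restrictCover (coverPow 𝒰 A) (π ⁻¹' {y})) : ℝ≥0∞) ≤ A.card * coverDim 𝒰 := by
  have := normalSpace_fiber hπ y
  have h := ENat.toENNReal_le.2 (coverDim_restrictCover_coverPow_le 𝒰 (π ⁻¹' {y}) A)
  rwa [ENat.toENNReal_mul, ENat.toENNReal_coe] at h

theorem coverDimGiven_coverPow_le (hπ : Continuous π) (ν : Measure Y) [IsProbabilityMeasure ν]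
    (𝒰 : Set (Set X)) (A : Finset Γ) :
    coverDimGiven π ν (coverPow 𝒰 A) ≤ A.card * coverDim 𝒰 := by
  refine (lintegral_mono fun y => coverDim_fiber_coverPow_le hπ 𝒰 A y).trans ?_
  simp

theorem coverDimGiven_coverPow_union_le [DecidableEq Γ] (hπ : Continuous π) (ν : Measure Y)
    {𝒰 : Set (Set X)} (h𝒰 : ∀ U ∈ 𝒰, IsOpen U) (A B : Finset Γ) :
    coverDimGiven π ν (coverPow 𝒰 (A ∪ B)) ≤
      coverDimGiven π ν (coverPow 𝒰 A) + coverDimGiven π ν (coverPow 𝒰 B) := by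
  rw [coverDimGiven, coverDimGiven, coverDimGiven,
    ← lintegral_add_left (measurable_coverDim_fiber hπ (isOpen_of_mem_coverPow h𝒰 A))]
  refine lintegral_mono fun y => ?_
  have := normalSpace_fiber hπ y
  have h := ENat.toENNReal_le.2 (coverDim_restrictCover_coverPow_union_le 𝒰 (π ⁻¹' {y}) A B)
  rwa [ENat.toENNReal_add] at h

variable [MulAction Γ Y] [ContinuousConstSMul Γ Y]

theorem coverDimGiven_coverPow_mul_singleton [DecidableEq Γ] (hπ : Continuous π)
    (hπ_equiv : ∀ (s : Γ) (x : X), π (s • x) = s • π x) (ν : Measure Y)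
    [SMulInvariantMeasure Γ Y ν] {𝒰 : Set (Set X)} (h𝒰 : ∀ U ∈ 𝒰, IsOpen U) (A : Finset Γ)
    (s : Γ) :
    coverDimGiven π ν (coverPow 𝒰 (A * {s})) = coverDimGiven π ν (coverPow 𝒰 A) := by
  simp only [coverDimGiven, coverDim_fiber_coverPow_mul_singleton hπ_equiv]
  exact (measurePreserving_smul s ν).lintegral_comp
    (measurable_coverDim_fiber hπ (isOpen_of_mem_coverPow h𝒰 A))

/-- The limits that define the mean dimension given an invariant measure exist. -/
theorem exists_tendsto_coverDimGiven (hπ : Continuous π)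
    (hπ_equiv : ∀ (s : Γ) (x : X), π (s • x) = s • π x) (ν : Measure Y) [IsProbabilityMeasure ν]
    [SMulInvariantMeasure Γ Y ν] {𝒰 : Set (Set X)} (h𝒰 : IsFiniteOpenCover 𝒰) :
    ∃ c : ℝ≥0, Tendsto
      (fun E : Finset Γ => coverDimGiven π ν (coverPow 𝒰 E) / (E.card : ℝ≥0∞))
      (invariantFilter Γ) (𝓝 (c : ℝ≥0∞)) := by
  classical
  obtain ⟨m, hm⟩ := ENat.ne_top_iff_exists.1 (coverDim_lt_top h𝒰).ne
  have hle : ∀ A : Finset Γ, coverDimGiven π ν (coverPow 𝒰 A) ≤ ((A.card * m : ℕ) : ℝ≥0∞) := by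
    intro A
    refine (coverDimGiven_coverPow_le hπ ν 𝒰 A).trans (le_of_eq ?_)
    rw [← hm, ENat.toENNReal_coe, Nat.cast_mul]
  have hfin : ∀ A : Finset Γ, coverDimGiven π ν (coverPow 𝒰 A) ≠ ∞ := fun A =>
    ((hle A).trans_lt (ENNReal.natCast_lt_top _)).ne
  obtain ⟨c, hc⟩ := exists_tendsto_div_card
    (fun A : Finset Γ => (coverDimGiven π ν (coverPow 𝒰 A)).toReal) (M := m)
    (by simp [coverDimGiven, coverDim_restrictCover_coverPow_empty])
    (fun A => ENNReal.toReal_nonneg)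
    (fun A B => by
      rw [← ENNReal.toReal_add (hfin A) (hfin B)]
      exact ENNReal.toReal_mono (ENNReal.add_ne_top.2 ⟨hfin A, hfin B⟩)
        (coverDimGiven_coverPow_union_le hπ ν h𝒰.isOpen A B))
    (fun A s => by rw [coverDimGiven_coverPow_mul_singleton hπ hπ_equiv ν h𝒰.isOpen])
    (fun A => by
      have h := ENNReal.toReal_mono (ENNReal.natCast_ne_top _) (hle A)
      rw [ENNReal.toReal_natCast, Nat.cast_mul, mul_comm] at h
      exact h)
  refine ⟨c.toNNReal, ?_⟩
  refine (ENNReal.tendsto_ofReal hc).congr' ?_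
  filter_upwards [almostInvariant_mem_invariantFilter (Finset.singleton_nonempty (1 : Γ))
    one_pos] with E hE
  rw [ENNReal.ofReal_div_of_pos (Nat.cast_pos.2 hE.1.card_pos), ENNReal.ofReal_toReal (hfin E),
    ENNReal.ofReal_natCast]

/-- The mean dimension given an invariant measure is at most the supremum of the mean dimensions
of the fibres. -/
theorem mdimGiven_le_iSup_mdimSubset (hπ : Continuous π)
    (hπ_equiv : ∀ (s : Γ) (x : X), π (s • x) = s • π x) {F : ℕ → Finset Γ} (hF : IsFolnerSeq F)
    (ν : Measure Y) [IsProbabilityMeasure ν] [SMulInvariantMeasure Γ Y ν] :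
    mdimGiven Γ π ν ≤ ⨆ y : Y, mdimSubset F (π ⁻¹' {y}) := by
  have hFt := hF.tendsto_invariantFilter
  have : (invariantFilter Γ).NeBot := hFt.neBot
  refine iSup₂_le fun 𝒰 h𝒰 => ?_
  obtain ⟨c, hc⟩ := exists_tendsto_coverDimGiven (Γ := Γ) hπ hπ_equiv ν h𝒰
  have hmeas : ∀ A : Finset Γ, Measurable fun y =>
      (coverDim (restrictCover (coverPow 𝒰 A) (π ⁻¹' {y})) : ℝ≥0∞) := fun A =>
    measurable_coverDim_fiber hπ (isOpen_of_mem_coverPow h𝒰.isOpen A)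
  have hlim : limsup (fun E : Finset Γ => coverDimGiven π ν (coverPow 𝒰 E) / (E.card : ℝ≥0∞))
      (invariantFilter Γ) = limsup (fun n => ∫⁻ y,
        (coverDim (restrictCover (coverPow 𝒰 (F n)) (π ⁻¹' {y})) : ℝ≥0∞) /
          ((F n).card : ℝ≥0∞) ∂ν) atTop := by
    -- Existence of the limit is what permits replacing the upper limit over the filter by the one
    -- along the Følner sequence.
    rw [hc.limsup_eq, ← (hc.comp hFt).limsup_eq]
    refine congrArg (fun u => limsup u atTop) (funext fun n => ?_)
    simp only [Function.comp_apply, div_eq_mul_inv, coverDimGiven]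
    rw [lintegral_mul_const _ (hmeas (F n))]
  rw [hlim]
  calc limsup (fun n => ∫⁻ y, (coverDim (restrictCover (coverPow 𝒰 (F n)) (π ⁻¹' {y})) : ℝ≥0∞) /
          ((F n).card : ℝ≥0∞) ∂ν) atTop
      ≤ ∫⁻ y, limsup (fun n => (coverDim (restrictCover (coverPow 𝒰 (F n)) (π ⁻¹' {y})) : ℝ≥0∞) /
          ((F n).card : ℝ≥0∞)) atTop ∂ν := by
        -- Reverse Fatou; the dominating constant is integrable since D(𝒰) is finite and ν is a
        -- probability measure.
        refine limsup_lintegral_le (fun _ => (coverDim 𝒰 : ℝ≥0∞))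
          (fun n => (hmeas (F n)).div_const _) (fun n => Eventually.of_forall fun y => ?_) ?_
        · refine ENNReal.div_le_of_le_mul ?_
          rw [mul_comm]
          exact coverDim_fiber_coverPow_le hπ 𝒰 (F n) y
        · simpa using (coverDim_lt_top h𝒰).ne
    _ ≤ ∫⁻ _, (⨆ y : Y, mdimSubset F (π ⁻¹' {y})) ∂ν := by
        refine lintegral_mono fun y => ?_
        exact le_iSup_of_le y (le_iSup₂_of_le 𝒰 h𝒰 le_rfl)
    _ = ⨆ y : Y, mdimSubset F (π ⁻¹' {y}) := by simp

end MeanDimensionGiven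

end MeanDim

theorem proposition4p3 {Γ X Y : Type*} [Group Γ] [Countable Γ] (hΓ : MeanDim.IsAmenable Γ)
    [TopologicalSpace X] [CompactSpace X] [TopologicalSpace.MetrizableSpace X]
    [MulAction Γ X] [ContinuousConstSMul Γ X]
    [TopologicalSpace Y] [CompactSpace Y] [TopologicalSpace.MetrizableSpace Y]
    [MulAction Γ Y] [ContinuousConstSMul Γ Y] [MeasurableSpace Y] [BorelSpace Y]
    (π : X → Y) (hπ_cont : Continuous π) (hπ_surj : Function.Surjective π)
    (hπ_equiv : ∀ (s : Γ) (x : X), π (s • x) = s • π x)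
    (F : ℕ → Finset Γ) (hF : MeanDim.IsFolnerSeq F) :
    -- the limits that define the mean dimension given an invariant measure exist
    (∀ ν : Measure Y, IsProbabilityMeasure ν → SMulInvariantMeasure Γ Y ν →
      ∀ 𝒰 : Set (Set X), MeanDim.IsFiniteOpenCover 𝒰 →
        ∃ c : ℝ≥0, Tendsto
          (fun E : Finset Γ =>
            MeanDim.coverDimGiven π ν (MeanDim.coverPow 𝒰 E) / (E.card : ℝ≥0∞))
          (MeanDim.invariantFilter Γ) (𝓝 (c : ℝ≥0∞))) ∧
    (⨆ (ν : Measure Y) (_ : IsProbabilityMeasure ν) (_ : SMulInvariantMeasure Γ Y ν),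
        MeanDim.mdimGiven Γ π ν) ≤
      ⨆ y : Y, MeanDim.mdimSubset F (π ⁻¹' {y}) := by
  refine ⟨fun ν _ _ 𝒰 h𝒰 => MeanDim.exists_tendsto_coverDimGiven hπ_cont hπ_equiv ν h𝒰, ?_⟩
  exact iSup_le fun ν => iSup_le fun _ => iSup_le fun _ =>
    MeanDim.mdimGiven_le_iSup_mdimSubset hπ_cont hπ_equiv hF ν
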